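/- **Theorem (Bounding cached reads).** Let $P, S \ge 1$ and $\tau \ge 1$ be integers. Consider $P$ partitions; the state of partition $j$ is a counter $C_j \in \{0,\dots,S-1\}$ and a finite queue $Q_j$ of jobs $(s,e)$, where $s$ is the size of the job and $e$ the number of steps since it was enqueued. In each time step one partition $w$ is chosen uniformly at random, independently of the past. In every partition the jobs with $e \ge \tau-1$ leave the queue and the remaining jobs $(s,e)$ become $(s,e+1)$. Moreover, for the chosen partition $w$, with $c$ the value of $C_w$ before the step, $C_w$ becomes $c+1 \bmod S$; and if $c+1$ is even and $i\ge 1$ is the largest integer with $2^i \mid c+1$, then all jobs of size at most $2^i$ are cancelled from $Q_w$ and a new job $(2^i,0)$ is enqueued there. This defines a Markov chain on the states of the system. For a window of time steps $t,t+1,\dots,t+\tau$, let $X_j$ be $\log_2$ of the size of the largest job that is in the queue of partition $j$ at one of the times $t,\dots,t+\tau$ ($X_j=0$ if there is none). In each step $t+i$, $0\le i\le\tau$, one partition $r_i$ is read, where $r_0,\dots,r_\tau$ are uniform on the $P$ partitions, independent of one another and of the state at time $t$ and the choices $w$; this creates $Y_i = X_{r_i}$ cached reads. Let $Y=\sum_{i=0}^{\tau}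 Y_i$. Assume $\tau = P$ and $0<\delta<1$. Then in steady state $$\Pr\Big[\,Y \ge 16P + 3\sqrt{P}\,\log_2 S\,\sqrt{\ln(1/\delta)}\,\Big] \le 2\delta .$$ Here "in steady state" means both of the following: (i) the inequality holds whenever the state at time $t$ has a stationary distribution of the Markov chain; (ii) for every initial distribution at time $0$, the $\limsup$ as $t\to\infty$ of the probability on the left is at most $2\delta$. -/

import Mathlib

open Filter
open scoped ENNReal

noncomputable section

namespace CachedReads

/-- The state of one partition: its counter modulo the capacity `S`, and its queue of
unfinished shuffling jobs. A job is a pair `(s, e)` where `s` is its size and `e` is the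
number of time steps elapsed since it was enqueued. -/
structure PartState (S : ℕ) where
  counter : Fin S
  queue : Finset (ℕ × ℕ)

/-- The state of the whole system: the states of its `P` partitions. -/
abbrev State (P S : ℕ) : Type := Fin P → PartState S

/-- One time step passes: every job gets one step older, and a job leaves the queue
when it has been there for `τ` steps. -/
def ageQueue (τ : ℕ) (Q : Finset (ℕ × ℕ)) : Finset (ℕ × ℕ) :=
  (Q.filter fun q => q.2 + 1 < τ).image fun q => (q.1, q.2 + 1)

/-- The largest `i` such that `2 ^ i` divides `c + 1`, for the counter value
`c ∈ {0, …, S - 1}`. -/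
def jobLevel {S : ℕ} (c : Fin S) : ℕ := padicValNat 2 (c.val + 1)

/-- A partition that is not chosen for writing in this step. -/
def PartState.idle {S : ℕ} (τ : ℕ) (s : PartState S) : PartState S where
  counter := s.counter
  queue := ageQueue τ s.queue

/-- A partition that is chosen for writing in this step. The counter advances modulo `S`.
If `c + 1` is a multiple of `2 ^ i` with `i` positive and as large as possible, then a job of
size `2 ^ i` is enqueued, and all jobs of size at most `2 ^ i` are cancelled. -/
def PartState.write {S : ℕ} [NeZero S] (τ : ℕ) (s : PartState S) : PartState S where
  counter := s.counter + 1
  queue :=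
    if 0 < jobLevel s.counter then
      insert (2 ^ jobLevel s.counter, 0)
        ((ageQueue τ s.queue).filter fun q => 2 ^ jobLevel s.counter < q.1)
    else ageQueue τ s.queue

/-- The state of the system after one time step in which partition `w` is chosen for writing. -/
def advance {P S : ℕ} [NeZero S] (τ : ℕ) (x : State P S) (w : Fin P) : State P S :=
  fun j => if j = w then (x j).write τ else (x j).idle τ

/-- The transition kernel of the system: the partition to be written is chosen uniformly. -/
def kernel {P S : ℕ} [NeZero P] [NeZero S] (τ : ℕ) (x : State P S) : PMF (State P S) :=
  (PMF.uniformOfFintype (Fin P)).map (advance τ x)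

/-- The law of the state after `t` time steps, if the initial state has law `μ`. -/
def lawAt {P S : ℕ} [NeZero P] [NeZero S] (τ : ℕ) (μ : PMF (State P S)) : ℕ → PMF (State P S)
  | 0 => μ
  | t + 1 => (lawAt τ μ t).bind (kernel τ)

/-- A stationary distribution of the Markov chain of the system. -/
def IsStationary {P S : ℕ} [NeZero P] [NeZero S] (τ : ℕ) (π : PMF (State P S)) : Prop :=
  π.bind (kernel τ) = π

/-- The state reached from `x` after the first `i` steps (`i ≤ τ`) of a window whose write
choices are `w`. -/
def stateAfter {P S : ℕ} [NeZero S] (τ : ℕ) (x : State P S) (w : Fin τ → Fin P) (i : ℕ) :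
    State P S :=
  ((List.ofFn w).take i).foldl (advance τ) x

/-- The size of the largest job in a queue, and `0` if the queue is empty. -/
def largestJob (Q : Finset (ℕ × ℕ)) : ℕ := Q.sup Prod.fst

/-- `X_j`: the binary logarithm of the size of the largest job that is in the queue of
partition `j` at one of the times `t, t + 1, …, t + τ` of the window, where `x` is the state at
time `t` (and `0` if there is no such job). Job sizes are powers of two. -/
def logMaxJob {P S : ℕ} [NeZero S] (τ : ℕ) (x : State P S) (w : Fin τ → Fin P) (j : Fin P) : ℕ :=
  Nat.log 2 ((Finset.range (τ + 1)).sup fun i => largestJob (stateAfter τ x w i j).queue)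

/-- `Y`: the number of cached reads created in the time steps `t, t + 1, …, t + τ`. The read of
time step `t + i` goes to partition `r i` and creates `X_{r i}` cached reads. -/
def numCachedReads {P S : ℕ} [NeZero S] (τ : ℕ) (x : State P S) (w : Fin τ → Fin P)
    (r : Fin (τ + 1) → Fin P) : ℕ :=
  ∑ i, logMaxJob τ x w (r i)

/-- The law of `Y` for a window at whose beginning the state has law `μ`: all write choices and
all read choices of the window are uniform on the `P` partitions, independent of one another and
of the state at the beginning of the window. -/
def cachedReadsLaw {P S : ℕ} [NeZero P] [NeZero S] (τ : ℕ) (μ : PMF (State P S)) : PMF ℕ :=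
  μ.bind fun x =>
    (PMF.uniformOfFintype ((Fin τ → Fin P) × (Fin (τ + 1) → Fin P))).map
      fun c => numCachedReads τ x c.1 c.2

end CachedReads

end

namespace CachedReads

open Finset
open scoped BigOperators

/-! ### Uniform averages over finite types -/

section Averages

/-! A job lives for fewer than `τ` steps, so every job seen during the window was enqueued in the
window or in the `τ` steps before it. Hence `X_j` is at most the largest level among `n_j`
consecutive counter values, where `n_j` counts the writes to `j` in these `2τ` steps
(`logMaxJob_foldl_le`), and the queues can be forgotten.

The counters form a chain of their own. Their sum grows by one per step, so the chain is periodic,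
but a write maps the vectors of one sum bijectively to those of the next. A Doeblin argument shows
that long-run averages exceed a common bound on the class averages by arbitrarily little
(`eventually_stepAvg_iterate_le`).

Within a class all counters but one are independent and uniform. With the writes fixed, the mean of
the level maximum at `j` is at most `n_j`, since levels average at most 1 over a cycle
(`expect_maxLevel_le`), and `∑ n_j = 2P`. Hoeffding's lemma for the reads and for the counters gives
the moment generating function of the sum (`expect_exp_sumLevels_le`), and Chernoff's bound gives
`δ` (`expect_ite_sumLevels_le`). The other `δ` pays for imperfect mixing. -/

lemma expect_prod_apply {ι α : Type*} [Fintype ι] [DecidableEq ι] [Fintype α]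
    (f : ι → α → ℝ) :
    𝔼 v : ι → α, ∏ j, f j (v j) = ∏ j, 𝔼 a, f j a := by
  have h := Finset.prod_univ_sum (fun _ : ι => (univ : Finset α)) f
  rw [Fintype.piFinset_univ] at h
  simp only [Fintype.expect_eq_sum_div_card, Finset.prod_div_distrib, h, Finset.prod_const,
    Fintype.card_fun, Finset.card_univ, Nat.cast_pow]

lemma expect_fin_cons {α : Type*} [Fintype α] (n : ℕ) (F : (Fin (n + 1) → α) → ℝ) :
    𝔼 v, F v = 𝔼 a, 𝔼 v, F (Fin.cons a v) := by
  rw [← Finset.expect_product', Finset.univ_product_univ]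
  exact (Fintype.expect_equiv (Fin.consEquiv fun _ => α) _ _ fun _ => rfl).symm

lemma expect_add_right {G : Type*} [Fintype G] [AddGroup G] (u : G) (F : G → ℝ) :
    𝔼 v, F (v + u) = 𝔼 v, F v :=
  Fintype.expect_equiv (Equiv.addRight u) _ _ fun _ => rfl

lemma expect_mono {ι : Type*} [Fintype ι] {f g : ι → ℝ} (h : ∀ i, f i ≤ g i) :
    𝔼 i, f i ≤ 𝔼 i, g i :=
  Finset.expect_le_expect fun i _ => h i

lemma expect_le_of_forall_le {ι : Type*} [Fintype ι] [Nonempty ι] {f : ι → ℝ} {a : ℝ}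
    (h : ∀ i, f i ≤ a) : 𝔼 i, f i ≤ a :=
  Finset.expect_le univ_nonempty fun i _ => h i

/-- Hoeffding's lemma for the uniform distribution on a finite type. -/
lemma expect_exp_le {ι : Type*} [Fintype ι] [Nonempty ι] (f : ι → ℝ) (b θ : ℝ)
    (h0 : ∀ i, 0 ≤ f i) (hb : ∀ i, f i ≤ b) :
    𝔼 i, Real.exp (θ * (f i - 𝔼 k, f k)) ≤ Real.exp (θ ^ 2 * b ^ 2 / 8) := by
  classical
  let _ : MeasurableSpace ι := ⊤
  have hint : ∀ g : ι → ℝ,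
      ∫ i, g i ∂(PMF.uniformOfFintype ι).toMeasure = 𝔼 i, g i := by
    intro g
    rw [PMF.integral_eq_sum, Fintype.expect_eq_sum_div_card, Finset.sum_div]
    refine Finset.sum_congr rfl fun i _ => ?_
    simp [PMF.uniformOfFintype_apply, div_eq_inv_mul]
  have hsub := ProbabilityTheory.hasSubgaussianMGF_of_mem_Icc
    (μ := (PMF.uniformOfFintype ι).toMeasure) (X := f) (a := 0) (b := b)
    (measurable_of_finite f).aemeasurable
    (MeasureTheory.ae_of_all _ fun i => ⟨h0 i, hb i⟩)
  have hm := hsub.mgf_le θ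
  rw [ProbabilityTheory.mgf, hint] at hm
  simp only [hint] at hm
  -- The variance proxy is `(b / 2) ^ 2`, which yields `θ ^ 2 * (b / 2) ^ 2 / 2`.
  refine hm.trans (Real.exp_le_exp.mpr (le_of_eq ?_))
  simp only [sub_zero, NNReal.coe_pow, NNReal.coe_div, coe_nnnorm, NNReal.coe_ofNat, div_pow,
    Real.norm_eq_abs, sq_abs]
  ring

end Averages

/-! ### Averaging operators driven by uniform choices -/

section Steps

variable {α X : Type*} [Fintype α]

/-- The average of `B` after one step of the dynamics `f` with a uniform choice. -/
noncomputable def stepAvg (f : X → α → X) (B : X → ℝ) (x : X) : ℝ := 𝔼 a, B (f x a)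

lemma stepAvg_iterate (f : X → α → X) (B : X → ℝ) (n : ℕ) (x : X) :
    (stepAvg f)^[n] B x = 𝔼 w : Fin n → α, B ((List.ofFn w).foldl f x) := by
  induction n generalizing x with
  | zero => simp
  | succ n ih =>
    rw [Function.iterate_succ_apply', stepAvg, expect_fin_cons]
    exact Finset.expect_congr rfl fun a _ => by simp [ih, List.ofFn_succ]

lemma stepAvg_mono (f : X → α → X) : Monotone (stepAvg f) :=
  fun _ _ h x => expect_mono fun a => h (f x a)

lemma stepAvg_nonneg (f : X → α → X) {B : X → ℝ} (h : ∀ x, 0 ≤ B x) (x : X) :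
    0 ≤ stepAvg f B x :=
  Finset.expect_nonneg fun a _ => h (f x a)

lemma stepAvg_iterate_le [Nonempty α] (f : X → α → X) {B : X → ℝ} {a : ℝ} (h : ∀ x, B x ≤ a)
    (n : ℕ) (x : X) : (stepAvg f)^[n] B x ≤ a := by
  rw [stepAvg_iterate]
  exact expect_le_of_forall_le fun w => h _

/-- If `π` intertwines two dynamics, averaging commutes with pulling back along `π`. -/
lemma stepAvg_iterate_comp {Y : Type*} (f : X → α → X) (g : Y → α → Y) (p : X → Y)
    (hp : ∀ x a, p (f x a) = g (p x) a) (B : Y → ℝ) (n : ℕ) :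
    (stepAvg f)^[n] (B ∘ p) = ((stepAvg g)^[n] B) ∘ p := by
  induction n with
  | zero => rfl
  | succ n ih =>
    rw [Function.iterate_succ_apply', Function.iterate_succ_apply', ih]
    funext x
    simp [stepAvg, hp]

end Steps


/-! ### Counters, queues and the largest level of a job -/

section Levels

lemma jobLevel_le {S : ℕ} (c : Fin S) : jobLevel c ≤ Nat.log 2 S :=
  (padicValNat_le_nat_log _).trans (Nat.log_mono_right c.isLt)

/-- The levels add up to the 2-adic valuation of `S!`, which by Legendre's formula is `S` minus the
binary digit sum of `S`. -/
lemma sum_jobLevel_le (S : ℕ) : ∑ c : Fin S, jobLevel c ≤ S := by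
  have h : ∀ n : ℕ, ∑ i ∈ range n, padicValNat 2 (i + 1) = padicValNat 2 n.factorial := by
    intro n
    induction n with
    | zero => simp
    | succ n ih =>
      rw [Finset.sum_range_succ, ih, Nat.factorial_succ,
        padicValNat.mul (by omega) (Nat.factorial_ne_zero n), add_comm]
  have h2 := sub_one_mul_padicValNat_factorial (p := 2) S
  have h3 : ∑ c : Fin S, jobLevel c = ∑ i ∈ range S, padicValNat 2 (i + 1) :=
    Fin.sum_univ_eq_sum_range (fun i => padicValNat 2 (i + 1)) S
  rw [h3, h]
  omega

variable {S : ℕ} [NeZero S]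

/-- The largest job level among `n` consecutive writes, starting with counter value `c`. -/
def maxLevel (c : Fin S) (n : ℕ) : ℕ := (range n).sup fun k => jobLevel (c + k • 1)

lemma maxLevel_le (c : Fin S) (n : ℕ) : maxLevel c n ≤ Nat.log 2 S :=
  Finset.sup_le fun _ _ => jobLevel_le _

lemma jobLevel_le_maxLevel (c : Fin S) {k n : ℕ} (h : k < n) :
    jobLevel (c + k • 1) ≤ maxLevel c n :=
  Finset.le_sup (f := fun k => jobLevel (c + k • 1)) (mem_range.mpr h)

lemma maxLevel_le_sum (c : Fin S) (n : ℕ) :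
    maxLevel c n ≤ ∑ k ∈ range n, jobLevel (c + k • 1) :=
  Finset.sup_le fun _ hk =>
    Finset.single_le_sum (f := fun k => jobLevel (c + k • 1)) (fun _ _ => Nat.zero_le _) hk

/-- A maximum is at most the sum, and each shifted counter is again uniform, with mean level at most
1. -/
lemma expect_maxLevel_le (n : ℕ) : 𝔼 c : Fin S, (maxLevel c n : ℝ) ≤ n := by
  have hS : (0 : ℝ) < S := Nat.cast_pos.mpr (NeZero.pos S)
  calc 𝔼 c : Fin S, (maxLevel c n : ℝ)
      ≤ 𝔼 c : Fin S, ∑ k ∈ range n, (jobLevel (c + k • 1) : ℝ) :=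
        expect_mono fun c => by exact_mod_cast maxLevel_le_sum c n
    _ = ∑ k ∈ range n, 𝔼 c : Fin S, (jobLevel (c + k • 1) : ℝ) := by
        rw [Finset.expect_sum_comm]
    _ ≤ ∑ _k ∈ range n, (1 : ℝ) := by
        refine Finset.sum_le_sum fun k _ => ?_
        rw [expect_add_right (k • (1 : Fin S)) fun c => (jobLevel c : ℝ),
          Fintype.expect_eq_sum_div_card, Fintype.card_fin, div_le_one hS]
        exact_mod_cast sum_jobLevel_le S
    _ = n := by simp

end Levels

/-! ### Dependence of the queues on counters and recent writes. -/

section Dynamics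

variable {P S : ℕ} [NeZero S]

/-- The counters of a state. -/
def counters (x : State P S) : Fin P → Fin S := fun j => (x j).counter

/-- The effect of a write to partition `w` on the counters. -/
def bump (c : Fin P → Fin S) (w : Fin P) : Fin P → Fin S :=
  fun j => if j = w then c j + 1 else c j

lemma counters_advance (τ : ℕ) (x : State P S) (w : Fin P) :
    counters (advance τ x w) = bump (counters x) w := by
  funext j
  by_cases h : j = w <;> simp [counters, advance, bump, h, PartState.write, PartState.idle]

lemma foldl_bump (c : Fin P → Fin S) (l : List (Fin P)) (j : Fin P) :
    l.foldl bump c j = c j + l.count j • 1 := by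
  induction l using List.reverseRecOn with
  | nil => simp
  | append_singleton l a ih =>
    rw [List.foldl_append, List.foldl_cons, List.foldl_nil, bump, ih, List.count_append]
    by_cases h : j = a
    · subst h
      simp [add_smul, add_assoc]
    · simp [h, Ne.symm h]

lemma counters_foldl (τ : ℕ) (x : State P S) (l : List (Fin P)) :
    counters (l.foldl (advance τ) x) = l.foldl bump (counters x) := by
  induction l generalizing x with
  | nil => rfl
  | cons a l ih => rw [List.foldl_cons, ih, counters_advance, List.foldl_cons]

lemma mem_ageQueue {τ : ℕ} {Q : Finset (ℕ × ℕ)} {q : ℕ × ℕ} (h : q ∈ ageQueue τ Q) :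
    q.2 < τ ∧ ∃ p ∈ Q, p.1 = q.1 ∧ p.2 + 1 = q.2 := by
  simp only [ageQueue, mem_image, mem_filter] at h
  obtain ⟨p, ⟨hp, hlt⟩, rfl⟩ := h
  exact ⟨hlt, p, hp, rfl, rfl⟩

/-- A job in the queue after one step was either enqueued in that step, or is an aged job. -/
lemma mem_queue_advance {τ : ℕ} {x : State P S} {w j : Fin P} {q : ℕ × ℕ}
    (h : q ∈ (advance τ x w j).queue) :
    (j = w ∧ q = (2 ^ jobLevel (x j).counter, 0)) ∨ q ∈ ageQueue τ (x j).queue := by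
  by_cases hj : j = w
  · simp only [advance, hj, if_true, PartState.write] at h ⊢
    split_ifs at h
    · rcases mem_insert.mp h with h | h
      · exact Or.inl ⟨trivial, h⟩
      · exact Or.inr (mem_filter.mp h).1
    · exact Or.inr h
  · simp only [advance, hj, if_false, PartState.idle] at h
    exact Or.inr h

/-- After the writes `l`, a job stems from one of these writes, or it is as old as `l` is long. -/
lemma mem_queue_foldl (τ : ℕ) (x : State P S) (l : List (Fin P)) (j : Fin P) (q : ℕ × ℕ)
    (h : q ∈ (l.foldl (advance τ) x j).queue) :
    (∃ k < l.count j, q.1 = 2 ^ jobLevel ((x j).counter + k • 1)) ∨ l.length ≤ q.2 := by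
  induction l using List.reverseRecOn generalizing q with
  | nil => simp
  | append_singleton l a ih =>
    rw [List.foldl_append, List.foldl_cons, List.foldl_nil] at h
    rcases mem_queue_advance h with ⟨rfl, rfl⟩ | h
    · left
      refine ⟨l.count j, by simp, ?_⟩
      have hc := congrFun (counters_foldl τ x l) j
      rw [foldl_bump] at hc
      simp only [counters] at hc
      rw [hc]
    · obtain ⟨-, p, hp, h1, h2⟩ := mem_ageQueue h
      rcases ih p hp with ⟨k, hk, he⟩ | hlen
      · exact Or.inl ⟨k, by rw [List.count_append]; omega, by rw [← h1, he]⟩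
      · right
        simp only [List.length_append, List.length_singleton]
        omega

lemma age_lt_of_mem_queue_foldl {τ : ℕ} (hτ : 0 < τ) (x : State P S) (l : List (Fin P))
    (hl : l ≠ []) (j : Fin P) (q : ℕ × ℕ) (h : q ∈ (l.foldl (advance τ) x j).queue) :
    q.2 < τ := by
  induction l using List.reverseRecOn with
  | nil => exact absurd rfl hl
  | append_singleton l a _ =>
    rw [List.foldl_append, List.foldl_cons, List.foldl_nil] at h
    rcases mem_queue_advance h with ⟨-, rfl⟩ | h
    · exact hτ
    · exact (mem_ageQueue h).1

/-- A job already present in `x` would by now have age at least `τ`, but after a step only ages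
below `τ` remain. So all jobs come from the writes `l`. -/
lemma largestJob_foldl_le {τ : ℕ} (hτ : 0 < τ) (x : State P S) (l : List (Fin P))
    (hl : τ ≤ l.length) (j : Fin P) :
    largestJob (l.foldl (advance τ) x j).queue ≤ 2 ^ maxLevel (counters x j) (l.count j) := by
  refine Finset.sup_le fun q hq => ?_
  have hne : l ≠ [] := by
    rintro rfl
    simp at hl
    omega
  have hage := age_lt_of_mem_queue_foldl hτ x l hne j q hq
  rcases mem_queue_foldl τ x l j q hq with ⟨k, hk, he⟩ | hlen
  · rw [he]
    exact Nat.pow_le_pow_right (by norm_num) (jobLevel_le_maxLevel _ hk)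
  · omega

lemma maxLevel_mono (c : Fin S) {m n : ℕ} (h : m ≤ n) : maxLevel c m ≤ maxLevel c n :=
  Finset.sup_mono (range_mono h)

/-- Here `u` holds the writes before the window. Each time of the window corresponds to a prefix of
`u ++ List.ofFn w`, and a prefix contains no more writes to `j` than the whole. -/
lemma logMaxJob_foldl_le {τ : ℕ} (hτ : 0 < τ) (x : State P S) (u : List (Fin P))
    (hu : τ ≤ u.length) (w : Fin τ → Fin P) (j : Fin P) :
    logMaxJob τ (u.foldl (advance τ) x) w j ≤
      maxLevel (counters x j) ((u ++ List.ofFn w).count j) := by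
  have hpow : (Finset.range (τ + 1)).sup
      (fun i => largestJob (stateAfter τ (u.foldl (advance τ) x) w i j).queue) ≤
      2 ^ maxLevel (counters x j) ((u ++ List.ofFn w).count j) := by
    refine Finset.sup_le fun i _ => ?_
    rw [stateAfter, ← List.foldl_append]
    refine (largestJob_foldl_le hτ x _ (by rw [List.length_append]; omega) j).trans
      (Nat.pow_le_pow_right (by norm_num) (maxLevel_mono _ ?_))
    rw [List.count_append, List.count_append]
    exact Nat.add_le_add_left ((List.take_sublist _ _).count_le _) _
  exact (Nat.log_mono_right hpow).trans (Nat.log_pow (by norm_num) _).le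

end Dynamics


/-! ### Mixing of the counters

A write increments the sum of all counters by one, so that the counters only mix within the
classes of counter vectors with a given sum. -/

section Mixing

variable {S m : ℕ} [NeZero S]

lemma val_nsmul_one (n : ℕ) : (n • (1 : Fin S)).val = n % S := by
  induction n with
  | zero => simp
  | succ n ih => rw [succ_nsmul, Fin.val_add, ih, Fin.val_one', ← Nat.add_mod]

lemma val_nsmul_one_self (c : Fin S) : c.val • (1 : Fin S) = c :=
  Fin.ext (by rw [val_nsmul_one, Nat.mod_eq_of_lt c.isLt])

lemma nsmul_one_eq_zero_iff (n : ℕ) : n • (1 : Fin S) = 0 ↔ S ∣ n := by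
  rw [Fin.ext_iff, val_nsmul_one, Fin.val_zero, Nat.dvd_iff_mod_eq_zero]

/-- A sequence of writes leading from one counter vector to another one with the same sum. -/
lemma exists_writes (c d : Fin (m + 1) → Fin S) (h : ∑ j, c j = ∑ j, d j) :
    ∃ w : Fin ((m + 1) * S) → Fin (m + 1), (List.ofFn w).foldl bump c = d := by
  classical
  set e : Fin (m + 1) → ℕ := fun j => (d j - c j).val with he
  have hsum : S ∣ ∑ j, e j := by
    rw [← nsmul_one_eq_zero_iff, ← Finset.sum_nsmul_assoc]
    simp only [he, val_nsmul_one_self, Finset.sum_sub_distrib, h, sub_self]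
  have hle : ∑ j, e j ≤ (m + 1) * S := by
    refine (Finset.sum_le_card_nsmul univ e S fun j _ => (d j - c j).isLt.le).trans ?_
    simp
  obtain ⟨p, hp⟩ : ∃ p, (m + 1) * S = ∑ j, e j + p := Nat.exists_eq_add_of_le hle
  -- The `p` surplus writes bring the length to exactly `(m + 1) * S`. They all go to partition 0,
  -- whose counter they leave unchanged because `S ∣ p`.
  have hpS : S ∣ p := (Nat.dvd_add_right hsum).mp (hp ▸ Nat.dvd_mul_left S (m + 1))
  set M : Multiset (Fin (m + 1)) := ∑ j, Multiset.replicate (e j) j + Multiset.replicate p 0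
    with hM
  have hlen : M.toList.length = (m + 1) * S := by
    rw [Multiset.length_toList, hM, Multiset.card_add, Multiset.card_sum, hp]
    simp
  have hcount : ∀ j, (M.toList.count j) • (1 : Fin S) = d j - c j := by
    intro j
    have h1 : M.toList.count j = e j + if j = 0 then p else 0 := by
      rw [← Multiset.coe_count, Multiset.coe_toList, hM, Multiset.count_add, Multiset.count_sum',
        Multiset.count_replicate]
      simp [Multiset.count_replicate, eq_comm]
    rw [h1, add_smul, he, val_nsmul_one_self]
    split_ifs
    · rw [(nsmul_one_eq_zero_iff p).mpr hpS, add_zero]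
    · simp
  refine ⟨fun i => M.toList.get (i.cast hlen.symm), ?_⟩
  have hl : List.ofFn (fun i : Fin ((m + 1) * S) => M.toList.get (i.cast hlen.symm)) =
      M.toList := by
    rw [← List.ofFn_congr hlen, List.ofFn_get]
  rw [hl]
  funext j
  rw [foldl_bump, hcount, add_sub_cancel]

/-- The counter vector with sum `s` whose last entries are `v`. -/
def ofTail (s : Fin S) (v : Fin m → Fin S) : Fin (m + 1) → Fin S :=
  Fin.cons (s - ∑ j, v j) v

lemma sum_ofTail (s : Fin S) (v : Fin m → Fin S) : ∑ j, ofTail s v j = s := by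
  rw [Fin.sum_univ_succ]
  simp [ofTail]

/-- The average of `g` over the counter vectors of any given sum is at most `a`. -/
def ClassAvgLE (g : (Fin (m + 1) → Fin S) → ℝ) (a : ℝ) : Prop :=
  ∀ s : Fin S, 𝔼 v : Fin m → Fin S, g (ofTail s v) ≤ a

lemma bump_ofTail_zero (s : Fin S) (v : Fin m → Fin S) :
    bump (ofTail s v) 0 = ofTail (s + 1) v := by
  funext j
  refine Fin.cases ?_ (fun i => ?_) j
  · simp only [bump, ofTail, if_true, Fin.cons_zero]
    abel
  · simp [bump, ofTail, Fin.succ_ne_zero]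

lemma bump_ofTail_succ (s : Fin S) (v : Fin m → Fin S) (i : Fin m) :
    bump (ofTail s v) i.succ = ofTail (s + 1) (v + Pi.single i 1) := by
  funext j
  refine Fin.cases ?_ (fun k => ?_) j
  · have h0 : (0 : Fin (m + 1)) ≠ i.succ := (Fin.succ_ne_zero i).symm
    simp only [bump, ofTail, if_neg h0, Fin.cons_zero, Pi.add_apply, Finset.sum_add_distrib,
      Finset.sum_pi_single', Finset.mem_univ, if_true]
    abel
  · by_cases h : k = i
    · subst h
      simp [bump, ofTail]
    · simp [bump, ofTail, h]

/-- For each fixed `w`, a write carries the class of sum `s` bijectively to that of sum `s + 1`: the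
tail is either kept or translated, so the uniform average is preserved. -/
lemma ClassAvgLE.stepAvg {g : (Fin (m + 1) → Fin S) → ℝ} {a : ℝ} (hg : ClassAvgLE g a) :
    ClassAvgLE (stepAvg bump g) a := by
  intro s
  simp only [CachedReads.stepAvg]
  rw [Finset.expect_comm]
  refine expect_le_of_forall_le fun w => ?_
  refine Fin.cases ?_ (fun i => ?_) w
  · simp only [bump_ofTail_zero]
    exact hg (s + 1)
  · simp only [bump_ofTail_succ]
    rw [expect_add_right (Pi.single i (1 : Fin S)) fun v => g (ofTail (s + 1) v)]
    exact hg (s + 1)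

lemma ClassAvgLE.stepAvg_iterate {g : (Fin (m + 1) → Fin S) → ℝ} {a : ℝ}
    (hg : ClassAvgLE g a) (n : ℕ) : ClassAvgLE ((CachedReads.stepAvg bump)^[n] g) a := by
  induction n with
  | zero => exact hg
  | succ n ih =>
    rw [Function.iterate_succ_apply']
    exact ih.stepAvg

/-- The part of an excess over the average which can survive `(m + 1) * S` steps. -/
noncomputable def contraction (S m : ℕ) : ℝ :=
  1 - ((Fintype.card (Fin ((m + 1) * S) → Fin (m + 1)) : ℝ))⁻¹

lemma contraction_lt_one (S m : ℕ) : contraction S m < 1 :=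
  sub_lt_self _ (inv_pos.mpr (by exact_mod_cast Fintype.card_pos))

/-- Doeblin's argument: some vector in the class of `c` has value at most `a`, and at least one of
the equally likely write sequences leads there. That sequence loses the whole excess `ε`. -/
lemma stepAvg_iterate_contract {g : (Fin (m + 1) → Fin S) → ℝ} {a ε : ℝ}
    (hg : ClassAvgLE g a) (h : ∀ c, g c ≤ a + ε) (c : Fin (m + 1) → Fin S) :
    (stepAvg bump)^[(m + 1) * S] g c ≤ a + contraction S m * ε := by
  obtain ⟨v, -, hv⟩ := Finset.exists_le_of_expect_le univ_nonempty (hg (∑ j, c j))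
  obtain ⟨w₀, hw₀⟩ := exists_writes c (ofTail (∑ j, c j) v) (sum_ofTail _ _).symm
  rw [stepAvg_iterate]
  have hb : ∀ w : Fin ((m + 1) * S) → Fin (m + 1),
      g ((List.ofFn w).foldl bump c) ≤ (a + ε) - if w = w₀ then ε else 0 := by
    intro w
    by_cases hw : w = w₀
    · rw [if_pos hw, hw, hw₀]
      linarith
    · rw [if_neg hw, sub_zero]
      exact h _
  refine (expect_mono hb).trans (le_of_eq ?_)
  rw [Finset.expect_sub_distrib, Fintype.expect_const, Fintype.expect_eq_sum_div_card,
    Finset.sum_ite_eq' univ w₀, if_pos (Finset.mem_univ _), contraction]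
  ring

lemma stepAvg_iterate_mul_le {g : (Fin (m + 1) → Fin S) → ℝ} {a : ℝ} (ha : 0 ≤ a)
    (hg : ClassAvgLE g a) (h : ∀ c, g c ≤ 1) (k : ℕ) (c : Fin (m + 1) → Fin S) :
    (stepAvg bump)^[(m + 1) * S * k] g c ≤ a + contraction S m ^ k := by
  induction k generalizing c with
  | zero =>
    have := h c
    simp only [mul_zero, Function.iterate_zero, id_eq, pow_zero]
    linarith
  | succ k ih =>
    rw [Nat.mul_succ, Nat.add_comm ((m + 1) * S * k), Function.iterate_add_apply, pow_succ']
    exact stepAvg_iterate_contract (hg.stepAvg_iterate _) ih c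

/-- Whatever the initial counters are, averages over long runs come close to the averages over
the classes. -/
lemma eventually_stepAvg_iterate_le {g : (Fin (m + 1) → Fin S) → ℝ} {a : ℝ} (ha : 0 ≤ a)
    (hg : ClassAvgLE g a) (h : ∀ c, g c ≤ 1) {ε : ℝ} (hε : 0 < ε) :
    ∀ᶠ t in atTop, ∀ c, (stepAvg bump)^[t] g c ≤ a + ε := by
  obtain ⟨k, hk⟩ := exists_pow_lt_of_lt_one hε (contraction_lt_one S m)
  filter_upwards [eventually_ge_atTop ((m + 1) * S * k)] with t ht c
  obtain ⟨r, rfl⟩ := Nat.exists_eq_add_of_le ht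
  rw [Nat.add_comm ((m + 1) * S * k), Function.iterate_add_apply]
  -- A bound uniform in the counters survives the `r` further averaging steps.
  exact stepAvg_iterate_le bump
    (fun c => (stepAvg_iterate_mul_le ha hg h k c).trans (by linarith)) r c

end Mixing


/-! ### The moment generating function of the number of cached reads -/

section Moments

lemma expect_exp_centered_le {ι : Type*} [Fintype ι] [Nonempty ι] (f : ι → ℝ) (b θ : ℝ)
    (h0 : ∀ i, 0 ≤ f i) (hb : ∀ i, f i ≤ b) :
    𝔼 i, Real.exp (θ * f i) ≤ Real.exp (θ * (𝔼 k, f k) + θ ^ 2 * b ^ 2 / 8) := by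
  have h : ∀ i, Real.exp (θ * f i) =
      Real.exp (θ * 𝔼 k, f k) * Real.exp (θ * (f i - 𝔼 k, f k)) := by
    intro i
    rw [← Real.exp_add]
    ring_nf
  simp only [h]
  rw [← Finset.mul_expect, Real.exp_add]
  exact mul_le_mul_of_nonneg_left (expect_exp_le f b θ h0 hb) (Real.exp_pos _).le

/-- Independent samples: the moment generating function of a sum of `n` values of `z`. -/
lemma expect_exp_sum_samples_le {ι : Type*} [Fintype ι] [Nonempty ι] (z : ι → ℝ) (b θ : ℝ)
    (h0 : ∀ i, 0 ≤ z i) (hb : ∀ i, z i ≤ b) (n : ℕ) :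
    𝔼 r : Fin n → ι, Real.exp (θ * ∑ i, z (r i)) ≤
      Real.exp (n * (θ * (𝔼 k, z k) + θ ^ 2 * b ^ 2 / 8)) := by
  simp only [Finset.mul_sum, Real.exp_sum]
  rw [expect_prod_apply (fun _ : Fin n => fun a => Real.exp (θ * z a)), Finset.prod_const,
    Finset.card_univ, Fintype.card_fin, Real.exp_nat_mul]
  exact pow_le_pow_left₀ (Finset.expect_nonneg fun _ _ => (Real.exp_pos _).le)
    (expect_exp_centered_le z b θ h0 hb) n

/-- The moment generating function of a sum of independent bounded variables. -/
lemma expect_exp_sum_indep_le {α : Type*} [Fintype α] [Nonempty α] (m : ℕ)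
    (f : Fin m → α → ℝ) (b θ : ℝ) (h0 : ∀ j a, 0 ≤ f j a) (hb : ∀ j a, f j a ≤ b) :
    𝔼 v : Fin m → α, Real.exp (θ * ∑ j, (f j (v j) - 𝔼 a, f j a)) ≤
      Real.exp (m * (θ ^ 2 * b ^ 2 / 8)) := by
  simp only [Finset.mul_sum, Real.exp_sum]
  rw [expect_prod_apply (fun j => fun a => Real.exp (θ * (f j a - 𝔼 a, f j a))),
    Real.exp_nat_mul]
  refine (Finset.prod_le_prod (fun j _ => Finset.expect_nonneg fun _ _ => (Real.exp_pos _).le)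
    fun j _ => expect_exp_le (f j) b θ (h0 j) (hb j)).trans (le_of_eq ?_)
  simp

variable {S m : ℕ} [NeZero S]

/-- The entry of a counter vector which is determined by the others is uniform. -/
lemma expect_sub_sum (s : Fin S) (F : Fin S → ℝ) :
    𝔼 v : Fin (m + 1) → Fin S, F (s - ∑ j, v j) = 𝔼 c, F c := by
  rw [expect_fin_cons, Finset.expect_comm]
  have h : ∀ v : Fin m → Fin S,
      𝔼 a : Fin S, F (s - ∑ j, (Fin.cons a v : Fin (m + 1) → Fin S) j) = 𝔼 c, F c := by
    intro v
    refine Fintype.expect_equiv (Equiv.subLeft (s - ∑ j, v j)) _ _ fun a => ?_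
    rw [Fin.sum_univ_succ]
    simp only [Fin.cons_zero, Fin.cons_succ, Equiv.subLeft_apply]
    congr 1
    abel
  simp only [h]
  exact Fintype.expect_const _

/-- The moment generating function of a sum of functions of the counters, if the counter vector is
uniform among those with sum `s`. -/
lemma expect_exp_sum_ofTail_le (s : Fin S) (f : Fin (m + 2) → Fin S → ℝ) (b θ : ℝ)
    (h0 : ∀ j a, 0 ≤ f j a) (hb : ∀ j a, f j a ≤ b) :
    𝔼 v : Fin (m + 1) → Fin S, Real.exp (θ * ∑ j, f j (ofTail s v j)) ≤
      Real.exp (θ * ∑ j, 𝔼 a, f j a + (m + 1) * (θ ^ 2 * b ^ 2 / 2)) := by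
  -- Entry 0 depends on the other entries. The inequality `exp ((A + B) / 2) ≤ (exp A + exp B) / 2`
  -- separates it from them, at the price of doubling `θ`, which turns the 8 of Hoeffding's lemma
  -- into a 2.
  set A : (Fin (m + 1) → Fin S) → ℝ :=
    fun v => 2 * θ * ∑ j, (f j.succ (v j) - 𝔼 a, f j.succ a) with hA
  set B : (Fin (m + 1) → Fin S) → ℝ :=
    fun v => 2 * θ * (f 0 (s - ∑ j, v j) - 𝔼 a, f 0 a) with hB
  have hle : ∀ v : Fin (m + 1) → Fin S, Real.exp (θ * ∑ j, f j (ofTail s v j)) ≤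
      Real.exp (θ * ∑ j, 𝔼 a, f j a) * ((Real.exp (A v) + Real.exp (B v)) / 2) := by
    intro v
    have h1 : θ * ∑ j, f j (ofTail s v j) =
        θ * ∑ j, 𝔼 a, f j a + (A v / 2 + B v / 2) := by
      rw [Fin.sum_univ_succ fun j => f j (ofTail s v j),
        Fin.sum_univ_succ fun j => 𝔼 a, f j a]
      simp only [hA, hB, ofTail, Fin.cons_zero, Fin.cons_succ, Finset.sum_sub_distrib]
      ring
    rw [h1, Real.exp_add]
    refine mul_le_mul_of_nonneg_left ?_ (Real.exp_pos _).le
    have hx : Real.exp (A v) = Real.exp (A v / 2) ^ 2 := by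
      rw [← Real.exp_nat_mul]
      congr 1
      push_cast
      ring
    have hy : Real.exp (B v) = Real.exp (B v / 2) ^ 2 := by
      rw [← Real.exp_nat_mul]
      congr 1
      push_cast
      ring
    rw [Real.exp_add, hx, hy]
    linarith [two_mul_le_add_sq (Real.exp (A v / 2)) (Real.exp (B v / 2))]
  have hEA : 𝔼 v, Real.exp (A v) ≤ Real.exp ((m + 1) * (θ ^ 2 * b ^ 2 / 2)) := by
    refine (expect_exp_sum_indep_le (m + 1) (fun j => f j.succ) b (2 * θ)
      (fun j => h0 _) (fun j => hb _)).trans (Real.exp_le_exp.mpr (le_of_eq ?_))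
    push_cast
    ring
  have hEB : 𝔼 v, Real.exp (B v) ≤ Real.exp ((m + 1) * (θ ^ 2 * b ^ 2 / 2)) := by
    rw [hB, expect_sub_sum s (fun c => Real.exp (2 * θ * (f 0 c - 𝔼 a, f 0 a)))]
    refine (expect_exp_le (f 0) b (2 * θ) (h0 0) (hb 0)).trans (Real.exp_le_exp.mpr ?_)
    have : 0 ≤ (m : ℝ) * (θ ^ 2 * b ^ 2 / 2) := by positivity
    linarith
  refine (expect_mono hle).trans ?_
  rw [← Finset.mul_expect, Real.exp_add, ← Finset.expect_div, Finset.expect_add_distrib]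
  refine mul_le_mul_of_nonneg_left ?_ (Real.exp_pos _).le
  linarith

/-- The sum of the levels read by `r`, for counters `c` and numbers `n` of writes. -/
def sumLevels {P k : ℕ} (c : Fin P → Fin S) (n : Fin P → ℕ) (r : Fin k → Fin P) : ℕ :=
  ∑ i, maxLevel (c (r i)) (n (r i))

lemma expect_exp_sumLevels_le (s : Fin S) (n : Fin (m + 2) → ℕ)
    (hn : ∑ j, n j = 2 * (m + 2)) {θ : ℝ} (hθ : 0 ≤ θ) :
    𝔼 v : Fin (m + 1) → Fin S, 𝔼 r : Fin (m + 2 + 1) → Fin (m + 2),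
      Real.exp (θ * (sumLevels (ofTail s v) n r : ℝ)) ≤
      Real.exp (2 * θ * (m + 3) + θ ^ 2 * (Nat.log 2 S : ℝ) ^ 2 * (5 * (m + 3)) / 8) := by
  set b : ℝ := (Nat.log 2 S : ℝ) with hb
  -- Averaging over the `m + 3` reads, each uniform on `m + 2` partitions, leaves this weight on the
  -- level of each partition.
  set θ' : ℝ := θ * (m + 3) / (m + 2) with hθ'
  have hm2 : (0 : ℝ) < (m : ℝ) + 2 := by positivity
  have hθ'0 : 0 ≤ θ' := by positivity
  have hmul : θ' * (m + 2) = θ * (m + 3) := by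
    rw [hθ']
    field_simp
  have h1 : ∀ v : Fin (m + 1) → Fin S, 𝔼 r : Fin (m + 2 + 1) → Fin (m + 2),
      Real.exp (θ * (sumLevels (ofTail s v) n r : ℝ)) ≤
      Real.exp ((m + 3) * (θ ^ 2 * b ^ 2 / 8)) *
        Real.exp (θ' * ∑ j, (maxLevel (ofTail s v j) (n j) : ℝ)) := by
    intro v
    have := expect_exp_sum_samples_le
      (fun j : Fin (m + 2) => (maxLevel (ofTail s v j) (n j) : ℝ)) b θ
      (fun _ => Nat.cast_nonneg _) (fun _ => Nat.cast_le.mpr (maxLevel_le _ _)) (m + 2 + 1)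
    simp only [sumLevels, Nat.cast_sum]
    refine this.trans (le_of_eq ?_)
    rw [← Real.exp_add, Fintype.expect_eq_sum_div_card, Fintype.card_fin, hθ']
    congr 1
    push_cast
    field_simp
    ring
  have h2 := expect_exp_sum_ofTail_le s (fun j a => (maxLevel a (n j) : ℝ)) b θ'
    (fun _ _ => Nat.cast_nonneg _) (fun _ _ => Nat.cast_le.mpr (maxLevel_le _ _))
  have h3 : ∑ j, 𝔼 a : Fin S, (maxLevel a (n j) : ℝ) ≤ 2 * (m + 2) := by
    refine (Finset.sum_le_sum fun j _ => expect_maxLevel_le (S := S) (n j)).trans (le_of_eq ?_)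
    exact_mod_cast hn
  refine (expect_mono h1).trans ?_
  rw [← Finset.mul_expect]
  refine (mul_le_mul_of_nonneg_left h2 (Real.exp_pos _).le).trans ?_
  rw [← Real.exp_add, Real.exp_le_exp]
  have h4 : θ' * ∑ j, 𝔼 a : Fin S, (maxLevel a (n j) : ℝ) ≤ 2 * θ * (m + 3) := by
    refine (mul_le_mul_of_nonneg_left h3 hθ'0).trans (le_of_eq ?_)
    linarith
  -- This is `(m + 1) * (m + 3) ≤ (m + 2) ^ 2`. Reads contribute 1/8 and counters 1/2 = 4/8 to the
  -- quadratic term, whence 5/8.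
  have h5 : ((m : ℝ) + 1) * θ' ^ 2 ≤ θ ^ 2 * (m + 3) := by
    have h6 : θ' ^ 2 * (m + 2) ^ 2 = θ ^ 2 * (m + 3) ^ 2 := by
      rw [← mul_pow, hmul, mul_pow]
    refine le_of_mul_le_mul_right ?_ (pow_pos hm2 2)
    have h7 : 0 ≤ θ ^ 2 * (m + 3) := by positivity
    nlinarith
  have h8 : ((m : ℝ) + 1) * θ' ^ 2 * b ^ 2 ≤ θ ^ 2 * (m + 3) * b ^ 2 :=
    mul_le_mul_of_nonneg_right h5 (sq_nonneg b)
  linarith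

/-- Chernoff's bound for the sum of the levels read, if there are at least two partitions. -/
lemma expect_ite_sumLevels_le (s : Fin S) (n : Fin (m + 2) → ℕ)
    (hn : ∑ j, n j = 2 * (m + 2)) {δ : ℝ} (hδ : 0 < δ) (hδ1 : δ < 1) :
    𝔼 v : Fin (m + 1) → Fin S, 𝔼 r : Fin (m + 2 + 1) → Fin (m + 2),
      (if 16 * ((m + 2 : ℕ) : ℝ) + 3 * √((m + 2 : ℕ) : ℝ) * Real.logb 2 S *
        √(Real.log (1 / δ)) ≤ (sumLevels (ofTail s v) n r : ℝ) then (1 : ℝ) else 0) ≤ δ := by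
  set b : ℝ := (Nat.log 2 S : ℝ) with hb
  set q : ℝ := √((m + 2 : ℕ) : ℝ) with hq
  set p : ℝ := √(Real.log (1 / δ)) with hp
  have hq0 : 0 < q := Real.sqrt_pos.mpr (by positivity)
  have hq2 : q ^ 2 = m + 2 := by
    rw [hq, Real.sq_sqrt (Nat.cast_nonneg _)]
    push_cast
    ring
  have hp2 : p ^ 2 = -Real.log δ := by
    rw [hp, Real.sq_sqrt (Real.log_nonneg ((one_le_div hδ).mpr hδ1.le)), one_div, Real.log_inv]
  have hp0 : 0 ≤ p := Real.sqrt_nonneg _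
  have hbL : b ≤ Real.logb 2 S := mod_cast Real.natLog_le_logb S 2
  have hb0 : 0 ≤ b := Nat.cast_nonneg _
  have hthr : 16 * ((m : ℝ) + 2) + 3 * q * b * p ≤
      16 * ((m + 2 : ℕ) : ℝ) + 3 * q * Real.logb 2 S * p := by
    push_cast
    gcongr
  -- If `b = 0`, all levels vanish and the choice of `θ` below would divide by zero.
  rcases hb0.eq_or_lt with hbz | hbpos
  · have hz : ∀ (v : Fin (m + 1) → Fin S) (r : Fin (m + 2 + 1) → Fin (m + 2)),
        (if 16 * ((m + 2 : ℕ) : ℝ) + 3 * q * Real.logb 2 S * p ≤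
          (sumLevels (ofTail s v) n r : ℝ) then (1 : ℝ) else 0) = 0 := by
      intro v r
      have hs : sumLevels (ofTail s v) n r = 0 := by
        refine Finset.sum_eq_zero fun i _ => Nat.le_zero.mp ?_
        refine (maxLevel_le _ _).trans (le_of_eq ?_)
        rw [hb] at hbz
        exact_mod_cast hbz.symm
      rw [if_neg]
      intro hcon
      have hcon' := hthr.trans hcon
      rw [hs, ← hbz, Nat.cast_zero] at hcon'
      have : (0 : ℝ) ≤ m := Nat.cast_nonneg m
      linarith
    simp only [hz, Finset.expect_const_zero]
    exact hδ.le
  -- With this `θ` the deviation term gives `-3 * p ^ 2` and the quadratic term at most `p ^ 2`,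
  -- while `16 * (m + 2)` absorbs the mean. The exponent is then at most `-p ^ 2 = log δ`.
  · set θ : ℝ := p / (b * q) with hθ
    have hθ0 : 0 ≤ θ := by positivity
    have hθb : θ * (b * q) = p := by
      rw [hθ]
      field_simp
    have hind : ∀ (v : Fin (m + 1) → Fin S) (r : Fin (m + 2 + 1) → Fin (m + 2)),
        (if 16 * ((m + 2 : ℕ) : ℝ) + 3 * q * Real.logb 2 S * p ≤
          (sumLevels (ofTail s v) n r : ℝ) then (1 : ℝ) else 0) ≤
        Real.exp (-(θ * (16 * ((m : ℝ) + 2) + 3 * q * b * p))) *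
          Real.exp (θ * (sumLevels (ofTail s v) n r : ℝ)) := by
      intro v r
      split_ifs with h
      · rw [← Real.exp_add]
        refine Real.one_le_exp ?_
        have := mul_le_mul_of_nonneg_left (hthr.trans h) hθ0
        linarith
      · positivity
    refine (expect_mono fun v => expect_mono fun r => hind v r).trans ?_
    simp only [← Finset.mul_expect]
    refine (mul_le_mul_of_nonneg_left (expect_exp_sumLevels_le s n hn hθ0)
      (Real.exp_pos _).le).trans ?_
    rw [← Real.exp_add]
    refine (Real.exp_le_exp.mpr ?_).trans (Real.exp_log hδ).le
    have e1 : θ * (3 * q * b * p) = 3 * p ^ 2 := by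
      linear_combination 3 * p * hθb
    have e2 : θ ^ 2 * b ^ 2 * (m + 2) = p ^ 2 := by
      rw [← hq2, ← hθb]
      ring
    have hm0 : (0 : ℝ) ≤ m := Nat.cast_nonneg m
    have e3 : θ ^ 2 * b ^ 2 * (5 * (m + 3)) / 8 ≤ p ^ 2 := by
      have : 0 ≤ θ ^ 2 * b ^ 2 := by positivity
      nlinarith
    have e4 : 2 * θ * (m + 3) ≤ θ * (16 * ((m : ℝ) + 2)) := by nlinarith
    nlinarith [sq_nonneg p]

end Moments


/-! ### From the law of the number of cached reads to averages -/

section Laws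

lemma toMeasure_map_uniformOfFintype {ι : Type*} [Fintype ι] [Nonempty ι] (f : ι → ℕ)
    (p : ℕ → Prop) [DecidablePred p] :
    ((PMF.uniformOfFintype ι).map f).toMeasure {y | p y} =
      ENNReal.ofReal (𝔼 i, if p (f i) then (1 : ℝ) else 0) := by
  classical
  let _ : MeasurableSpace ι := ⊤
  have hcard : (0 : ℝ) < Fintype.card ι := Nat.cast_pos.mpr Fintype.card_pos
  rw [PMF.toMeasure_map_apply f _ _ (measurable_of_finite f) (by trivial),
    PMF.toMeasure_uniformOfFintype_apply (hs := by trivial), Fintype.expect_eq_sum_div_card,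
    ENNReal.ofReal_div_of_pos hcard, ENNReal.ofReal_natCast, Finset.sum_boole,
    ENNReal.ofReal_natCast, Fintype.card_ofFinset]
  congr!

variable {P S : ℕ} [NeZero S]

/-- The probability that a window which begins in the state `x` creates at least `a` cached
reads. -/
noncomputable def windowProb (τ : ℕ) (a : ℝ) (x : State P S) : ℝ :=
  open Classical in 𝔼 c : (Fin τ → Fin P) × (Fin (τ + 1) → Fin P),
    if a ≤ (numCachedReads τ x c.1 c.2 : ℝ) then (1 : ℝ) else 0

lemma windowProb_nonneg (τ : ℕ) (a : ℝ) (x : State P S) : 0 ≤ windowProb τ a x :=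
  Finset.expect_nonneg fun _ _ => by split_ifs <;> norm_num

/-- The number of writes to partition `j` in two sequences of writes. -/
def writeCount {k l : ℕ} (u : Fin k → Fin P) (w : Fin l → Fin P) (j : Fin P) : ℕ :=
  (List.ofFn u ++ List.ofFn w).count j

lemma sum_writeCount {k l : ℕ} (u : Fin k → Fin P) (w : Fin l → Fin P) :
    ∑ j, writeCount u w j = k + l := by
  have h := Multiset.sum_count_eq_card (s := univ)
    (m := ((List.ofFn u ++ List.ofFn w : List (Fin P)) : Multiset (Fin P)))
    fun a _ => Finset.mem_univ a
  simpa [writeCount] using h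

/-- A bound for the probability that at least `a` cached reads are created in a window, in terms
of the counters `τ` steps before the window. -/
noncomputable def levelProb (τ : ℕ) (a : ℝ) (c : Fin P → Fin S) : ℝ :=
  open Classical in 𝔼 u : Fin τ → Fin P, 𝔼 w : Fin τ → Fin P, 𝔼 r : Fin (τ + 1) → Fin P,
    if a ≤ (sumLevels c (writeCount u w) r : ℝ) then (1 : ℝ) else 0

/-- Starting `τ` steps before the window removes the influence of the initial queues, so the bound
depends on the counters alone. -/
lemma stepAvg_iterate_windowProb_le {τ : ℕ} (hτ : 0 < τ) (a : ℝ) (x : State P S) :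
    (stepAvg (advance τ))^[τ] (windowProb τ a) x ≤ levelProb τ a (counters x) := by
  rw [stepAvg_iterate]
  refine expect_mono fun u => ?_
  rw [windowProb, ← Finset.univ_product_univ, Finset.expect_product]
  refine expect_mono fun w => expect_mono fun r => ?_
  have h : numCachedReads τ ((List.ofFn u).foldl (advance τ) x) w r ≤
      sumLevels (counters x) (writeCount u w) r :=
    Finset.sum_le_sum fun i _ => logMaxJob_foldl_le hτ x _ (by simp) w (r i)
  split_ifs with h1 h2
  · exact le_rfl
  · exact absurd (h1.trans (Nat.cast_le.mpr h)) h2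
  · exact zero_le_one
  · exact le_rfl

variable [NeZero P]

lemma levelProb_le_one (τ : ℕ) (a : ℝ) (c : Fin P → Fin S) : levelProb τ a c ≤ 1 :=
  expect_le_of_forall_le fun _ => expect_le_of_forall_le fun _ => expect_le_of_forall_le fun _ => by
    split_ifs <;> norm_num

lemma cachedReadsLaw_apply (τ : ℕ) (a : ℝ) (μ : PMF (State P S)) :
    (cachedReadsLaw τ μ).toMeasure {y : ℕ | a ≤ (y : ℝ)} =
      ∑' x, μ x * ENNReal.ofReal (windowProb τ a x) := by
  classical
  rw [cachedReadsLaw, PMF.toMeasure_bind_apply _ _ _ (by trivial)]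
  refine tsum_congr fun x => ?_
  rw [toMeasure_map_uniformOfFintype _ fun y : ℕ => a ≤ (y : ℝ)]
  congr 3

lemma tsum_bind_mul {α β : Type*} (p : PMF α) (f : α → PMF β) (g : β → ℝ≥0∞) :
    ∑' b, p.bind f b * g b = ∑' a, p a * ∑' b, f a b * g b := by
  simp only [PMF.bind_apply, ← ENNReal.tsum_mul_right, ← ENNReal.tsum_mul_left, mul_assoc]
  exact ENNReal.tsum_comm

lemma tsum_kernel_mul (τ : ℕ) (x : State P S) (B : State P S → ℝ) (hB : ∀ x, 0 ≤ B x) :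
    ∑' y, kernel τ x y * ENNReal.ofReal (B y) =
      ENNReal.ofReal (stepAvg (advance τ) B x) := by
  have hcard : (0 : ℝ) < Fintype.card (Fin P) := Nat.cast_pos.mpr Fintype.card_pos
  have hpure : ∀ z : State P S,
      ∑' y, PMF.pure z y * ENNReal.ofReal (B y) = ENNReal.ofReal (B z) := by
    intro z
    rw [tsum_eq_single z fun y hy => by rw [PMF.pure_apply_of_ne _ _ hy, zero_mul],
      PMF.pure_apply_self, one_mul]
  rw [kernel, PMF.map, tsum_bind_mul]
  simp only [Function.comp_apply, hpure, PMF.uniformOfFintype_apply, tsum_fintype]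
  rw [stepAvg, Fintype.expect_eq_sum_div_card, ENNReal.ofReal_div_of_pos hcard,
    ENNReal.ofReal_natCast, ENNReal.ofReal_sum_of_nonneg fun _ _ => hB _, ← Finset.mul_sum,
    ENNReal.div_eq_inv_mul]

/-- Duality: moving the law forward equals averaging the observable backward. -/
lemma tsum_lawAt_mul (τ : ℕ) (μ : PMF (State P S)) (t : ℕ) (B : State P S → ℝ)
    (hB : ∀ x, 0 ≤ B x) :
    ∑' x, lawAt τ μ t x * ENNReal.ofReal (B x) =
      ∑' x, μ x * ENNReal.ofReal ((stepAvg (advance τ))^[t] B x) := by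
  induction t generalizing B with
  | zero => rfl
  | succ t ih =>
    rw [lawAt, tsum_bind_mul]
    simp only [tsum_kernel_mul τ _ B hB]
    rw [ih _ (stepAvg_nonneg _ hB), Function.iterate_succ_apply]

lemma lawAt_of_isStationary {τ : ℕ} {π : PMF (State P S)} (h : IsStationary τ π) (t : ℕ) :
    lawAt τ π t = π := by
  induction t with
  | zero => rfl
  | succ t ih => rw [lawAt, ih, h]

/-- The probability of many cached reads after a long run is at most the probability given by
averaging over a long run of the counters. -/
lemma cachedReadsLaw_lawAt_le {τ : ℕ} (hτ : 0 < τ) (a : ℝ) (μ : PMF (State P S)) (t : ℕ)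
    {B : ℝ} (hB : ∀ c : Fin P → Fin S, (stepAvg bump)^[t] (levelProb τ a) c ≤ B) :
    (cachedReadsLaw τ (lawAt τ μ (t + τ))).toMeasure {y : ℕ | a ≤ (y : ℝ)} ≤
      ENNReal.ofReal B := by
  rw [cachedReadsLaw_apply, tsum_lawAt_mul τ μ _ _ (windowProb_nonneg τ a)]
  have h : ∀ x : State P S, (stepAvg (advance τ))^[t + τ] (windowProb τ a) x ≤ B := by
    intro x
    rw [Function.iterate_add_apply]
    -- The last `τ` steps flush the queues. The earlier `t` steps then act on a function of the
    -- counters, where `advance` reduces to `bump`.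
    have hle : (stepAvg (advance τ))^[τ] (windowProb τ a) ≤
        (levelProb τ a ∘ counters : State P S → ℝ) := stepAvg_iterate_windowProb_le hτ a
    refine ((stepAvg_mono (advance (P := P) (S := S) τ)).iterate t hle x).trans ?_
    rw [stepAvg_iterate_comp (advance τ) bump counters (counters_advance τ)]
    exact hB _
  calc ∑' x, μ x * ENNReal.ofReal ((stepAvg (advance τ))^[t + τ] (windowProb τ a) x)
      ≤ ∑' x, μ x * ENNReal.ofReal B :=
        ENNReal.tsum_le_tsum fun x => mul_le_mul_right (ENNReal.ofReal_le_ofReal (h x)) _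
    _ = ENNReal.ofReal B := by rw [ENNReal.tsum_mul_right, μ.tsum_coe, one_mul]

/-- With a single partition, so many cached reads as to exceed the threshold are impossible. -/
lemma levelProb_one_eq_zero {P : ℕ} [NeZero P] (hP : P = 1) {δ : ℝ} (hδ : 0 < δ)
    (hδ2 : δ < 1 / 2) (c : Fin P → Fin S) :
    levelProb P (16 * (P : ℝ) + 3 * √(P : ℝ) * Real.logb 2 S * √(Real.log (1 / δ))) c = 0 := by
  subst hP
  refine Finset.expect_eq_zero fun u _ => Finset.expect_eq_zero fun w _ =>
    Finset.expect_eq_zero fun r _ => if_neg ?_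
  have h1 : sumLevels c (writeCount u w) r ≤ 2 * Nat.log 2 S := by
    refine (Finset.sum_le_card_nsmul univ _ (Nat.log 2 S) fun i _ => maxLevel_le _ _).trans ?_
    simp
  have h2 : (sumLevels c (writeCount u w) r : ℝ) ≤ 2 * (Nat.log 2 S : ℝ) := by exact_mod_cast h1
  have hbL : (Nat.log 2 S : ℝ) ≤ Real.logb 2 S := mod_cast Real.natLog_le_logb S 2
  have hb0 : (0 : ℝ) ≤ Nat.log 2 S := Nat.cast_nonneg _
  -- The two reads give at most `2 * Nat.log 2 S`, so `3 * √(log (1 / δ)) ≥ 2` suffices; it follows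
  -- from `δ < 1 / 2` and `log 2 > 4 / 9`.
  have h3 : (2 / 3 : ℝ) ≤ √(Real.log (1 / δ)) := by
    refine Real.le_sqrt_of_sq_le ?_
    have h4 : Real.log 2 ≤ Real.log (1 / δ) := by
      refine Real.log_le_log (by norm_num) ?_
      rw [le_div_iff₀ hδ]
      linarith
    have := Real.log_two_gt_d9
    have h23 : (2 / 3 : ℝ) ^ 2 ≤ 0.6931471803 := by norm_num
    linarith
  have h5 : 2 / 3 * Real.logb 2 S ≤ Real.logb 2 S * √(Real.log (1 / δ)) := by
    rw [mul_comm]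
    exact mul_le_mul_of_nonneg_left h3 (hb0.trans hbL)
  rw [Nat.cast_one, Real.sqrt_one]
  intro h
  linarith

lemma classAvgLE_levelProb {m : ℕ} {δ : ℝ} (hδ : 0 < δ) (hδ1 : δ < 1 / 2) :
    ClassAvgLE (S := S) (m := m) (levelProb (m + 1) (16 * ((m + 1 : ℕ) : ℝ) +
      3 * √((m + 1 : ℕ) : ℝ) * Real.logb 2 S * √(Real.log (1 / δ)))) δ := by
  intro s
  -- With one partition each class is a single vector, so there is no randomness in the counters to
  -- exploit.
  rcases m with _ | m
  · simp only [levelProb_one_eq_zero rfl hδ hδ1, Finset.expect_const_zero]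
    exact hδ.le
  · simp only [levelProb]
    -- Exchanging the averages fixes the writes, and so the counts, before averaging over counters
    -- and reads.
    rw [Finset.expect_comm]
    refine expect_le_of_forall_le fun u => ?_
    rw [Finset.expect_comm]
    refine expect_le_of_forall_le fun w => ?_
    refine (le_of_eq ?_).trans (expect_ite_sumLevels_le s (writeCount u w)
      (by rw [sum_writeCount]; ring) hδ (hδ1.trans (by norm_num)))
    congr!

/-- After a sufficiently long run the bound holds for every initial distribution. -/
lemma eventually_cachedReadsLaw_le {τ : ℕ} (hτ : τ = P) {δ : ℝ} (hδ : 0 < δ) :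
    ∀ᶠ t in atTop, ∀ μ : PMF (State P S),
      (cachedReadsLaw τ (lawAt τ μ t)).toMeasure
        {y : ℕ | 16 * (P : ℝ) + 3 * √(P : ℝ) * Real.logb 2 S * √(Real.log (1 / δ)) ≤ (y : ℝ)}
        ≤ ENNReal.ofReal (2 * δ) := by
  subst hτ
  rcases le_or_gt (1 / 2) δ with h2 | h2
  -- Here `2 * δ ≥ 1` and any probability will do.
  · refine Eventually.of_forall fun t μ => ?_
    refine MeasureTheory.prob_le_one.trans ?_
    rw [ENNReal.one_le_ofReal]
    linarith
  · obtain ⟨m, rfl⟩ := Nat.exists_eq_succ_of_ne_zero (NeZero.ne τ)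
    -- The class average is at most `δ`, and the mixing error is also taken to be `δ`.
    have h := eventually_stepAvg_iterate_le hδ.le (classAvgLE_levelProb (S := S) (m := m) hδ h2)
      (levelProb_le_one _ _) hδ
    obtain ⟨T, hT⟩ := eventually_atTop.mp h
    filter_upwards [eventually_ge_atTop (T + (m + 1))] with t ht μ
    obtain ⟨r, rfl⟩ := Nat.exists_eq_add_of_le ht
    rw [show T + (m + 1) + r = (T + r) + (m + 1) by ring, two_mul δ]
    exact cachedReadsLaw_lawAt_le (Nat.succ_pos m) _ μ _ (hT _ (Nat.le_add_right T r))

end Laws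

end CachedReads

theorem mainTheorem7 (P S τ : ℕ) [NeZero P] [NeZero S] (hτ : τ = P)
    (δ : ℝ) (hδ : 0 < δ) (hδ1 : δ < 1) :
    -- the system is in steady state: the window begins in a stationary distribution
    (∀ π : PMF (CachedReads.State P S), CachedReads.IsStationary τ π →
      (CachedReads.cachedReadsLaw τ π).toMeasure
        {y : ℕ | 16 * (P : ℝ) + 3 * √(P : ℝ) * Real.logb 2 S * √(Real.log (1 / δ)) ≤ (y : ℝ)}
        ≤ ENNReal.ofReal (2 * δ)) ∧
    -- the system reaches its steady state: the window begins at time `t → ∞`,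
    -- after an arbitrary start
    (∀ μ : PMF (CachedReads.State P S),
      limsup (fun t : ℕ =>
        (CachedReads.cachedReadsLaw τ (CachedReads.lawAt τ μ t)).toMeasure
          {y : ℕ | 16 * (P : ℝ) + 3 * √(P : ℝ) * Real.logb 2 S * √(Real.log (1 / δ)) ≤ (y : ℝ)})
        atTop ≤ ENNReal.ofReal (2 * δ)) := by
  have h := CachedReads.eventually_cachedReadsLaw_le (P := P) (S := S) hτ hδ
  refine ⟨fun π hπ => ?_, fun μ => ?_⟩
  -- A stationary law is its own law at every time, so a single good `t` suffices.
  · obtain ⟨t, ht⟩ := h.exists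
    rw [← CachedReads.lawAt_of_isStationary hπ t]
    exact ht π
  · exact limsup_le_of_le (h := h.mono fun t ht => ht μ)
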